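/- Let $\mathbb{T}\subset\mathbb{R}$ be a bounded time scale, i.e. a nonempty compact set, with at least three points; put $a=\min\mathbb{T}$, $b=\max\mathbb{T}$. For $t\in\mathbb{T}$ let $\sigma(t)=\inf\{s\in\mathbb{T}: s>t\}$ and $\rho(t)=\sup\{s\in\mathbb{T}: s<t\}$, with $\inf\emptyset=b$ and $\sup\emptyset=a$, and put $\mathbb{T}^\kappa=\mathbb{T}\setminus(\rho(b),b]$, $\mathbb{T}_\kappa=\mathbb{T}\setminus[a,\sigma(a))$, $\mathbb{T}^\kappa_\kappa=\mathbb{T}^\kappa\cap\mathbb{T}_\kappa$. A function $f$ is $\Delta$-differentiable at $t\in\mathbb{T}^\kappa$ (resp. $\nabla$-differentiable at $t\in\mathbb{T}_\kappa$) if the limit $$f^\Delta(t)=\lim_{s\to t,\ s\neq\sigma(t)}\frac{f(\sigma(t))-f(s)}{\sigma(t)-s}\qquad\Bigl(\text{resp. } f^\nabla(t)=\lim_{s\to t,\ s\neq\rho(t)}\frac{f(s)-f(\rho(t))}{s-\rho(t)}\Bigr)$$ over points $s$ of $\mathbb{T}$ exists. Let $n\geq 1$ and let $\mathrm{C}^{1,\Delta}_{\mathrm{rd}}(\mathbb{T})$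 be the set of all $u:\mathbb{T}\to\mathbb{R}^n$ that are $\Delta$-differentiable on $\mathbb{T}^\kappa$ with $u^\Delta$ rd-continuous (continuous at every $t$ with $\sigma(t)=t$, and having a left-sided limit at every $t$ with $\rho(t)=t$). For rd-continuous $f:\mathbb{T}^\kappa\to\mathbb{R}$ let $\int_a^b f(\tau)\,\Delta\tau=F(b)-F(a)$, where $F:\mathbb{T}\to\mathbb{R}$ satisfies $F^\Delta=f$ on $\mathbb{T}^\kappa$. Let $L:\mathbb{R}^n\times\mathbb{R}^n\times\mathbb{T}^\kappa\to\mathbb{R}$, $(x,v,t)\mapsto L(x,v,t)$, be continuous and of class $\mathscr{C}^1$ in $(x,v)$, with $\partial L/\partial x$ and $\partial L/\partial v$ continuous on $\mathbb{R}^n\times\mathbb{R}^n\times\mathbb{T}^\kappa$, and let $$\mathcal{L}(u)=\int_a^b L(u(\tau),u^\Delta(\tau),\tau)\,\Delta\tau,\qquad u\in\mathrm{C}^{1,\Delta}_{\mathrm{rd}}(\mathbb{T}).$$ Call $u$ a critical point of $\mathcal{L}$ if the Gâteaux differential satisfies $D\mathcal{L}(u)(w)=0$ for every $w\in\mathrm{C}^{1,\Delta}_{\mathrm{rd}}(\mathbb{T})$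 with $w(a)=w(b)=0$. **Theorem.** Assume that $\sigma$ is $\nabla$-differentiable on $\mathbb{T}_\kappa$, and let $u\in\mathrm{C}^{1,\Delta}_{\mathrm{rd}}(\mathbb{T})$. Then $u$ is a critical point of $\mathcal{L}$ if and only if, for every $t\in\mathbb{T}^\kappa_\kappa$, the function $\frac{\partial L}{\partial v}(u,u^\Delta,\cdot)$ is $\nabla$-differentiable at $t$ and $$\Bigl[\frac{\partial L}{\partial v}(u,u^\Delta,\cdot)\Bigr]^\nabla(t)=\sigma^\nabla(t)\,\frac{\partial L}{\partial x}(u(t),u^\Delta(t),t).$$ -/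

import Mathlib

open Set Filter Topology

noncomputable section

namespace TimeScale

/-! A bounded time scale is a set `T : Set ℝ` that is closed, bounded and nonempty. Functions on `T`
are represented by functions on `ℝ`; every notion below looks only at their values on `T`. -/

/-- The left end point `a = min T`. -/
def left (T : Set ℝ) : ℝ := sInf T

/-- The right end point `b = max T`. -/
def right (T : Set ℝ) : ℝ := sSup T

open Classical in
/-- The forward jump operator `σ(t) = inf {s ∈ T, s > t}`, with `inf ∅ = b`. -/
def sigma (T : Set ℝ) (t : ℝ) : ℝ :=
  if {s ∈ T | t < s}.Nonempty then sInf {s ∈ T | t < s} else right T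

open Classical in
/-- The backward jump operator `ρ(t) = sup {s ∈ T, s < t}`, with `sup ∅ = a`. -/
def rho (T : Set ℝ) (t : ℝ) : ℝ :=
  if {s ∈ T | s < t}.Nonempty then sSup {s ∈ T | s < t} else left T

/-- `T^κ = T \ ]ρ(b), b]`. -/
def upperKappa (T : Set ℝ) : Set ℝ := T \ Ioc (rho T (right T)) (right T)

/-- `T_κ = T \ [a, σ(a)[`. -/
def lowerKappa (T : Set ℝ) : Set ℝ := T \ Ico (left T) (sigma T (left T))

section Derivatives

variable {F : Type*} [NormedAddCommGroup F] [NormedSpace ℝ F]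

/-- `u` has `Δ`-derivative `u'` at `t` (meant for `t ∈ T^κ`): the quotient
`(u(σ(t)) - u(s)) / (σ(t) - s)` tends to `u'` as `s → t`, `s ∈ T`, `s ≠ σ(t)`
(the value `s = t` is allowed when `t ≠ σ(t)`). -/
def HasDeltaDerivAt (T : Set ℝ) (u : ℝ → F) (u' : F) (t : ℝ) : Prop :=
  Tendsto (fun s => (sigma T t - s)⁻¹ • (u (sigma T t) - u s)) (𝓝[T \ {sigma T t}] t) (𝓝 u')

/-- `u` is `Δ`-differentiable at `t`. -/
def DeltaDifferentiableAt (T : Set ℝ) (u : ℝ → F) (t : ℝ) : Prop :=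
  ∃ u' : F, HasDeltaDerivAt T u u' t

/-- The `Δ`-derivative `u^Δ(t)`, meaningful where `u` is `Δ`-differentiable. -/
def deltaDeriv (T : Set ℝ) (u : ℝ → F) (t : ℝ) : F :=
  limUnder (𝓝[T \ {sigma T t}] t) (fun s => (sigma T t - s)⁻¹ • (u (sigma T t) - u s))

/-- `u` has `∇`-derivative `u'` at `t` (meant for `t ∈ T_κ`): the quotient
`(u(s) - u(ρ(t))) / (s - ρ(t))` tends to `u'` as `s → t`, `s ∈ T`, `s ≠ ρ(t)`. -/
def HasNablaDerivAt (T : Set ℝ) (u : ℝ → F) (u' : F) (t : ℝ) : Prop :=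
  Tendsto (fun s => (s - rho T t)⁻¹ • (u s - u (rho T t))) (𝓝[T \ {rho T t}] t) (𝓝 u')

/-- `u` is `∇`-differentiable at `t`. -/
def NablaDifferentiableAt (T : Set ℝ) (u : ℝ → F) (t : ℝ) : Prop :=
  ∃ u' : F, HasNablaDerivAt T u u' t

/-- The `∇`-derivative `u^∇(t)`, meaningful where `u` is `∇`-differentiable. -/
def nablaDeriv (T : Set ℝ) (u : ℝ → F) (t : ℝ) : F :=
  limUnder (𝓝[T \ {rho T t}] t) (fun s => (s - rho T t)⁻¹ • (u s - u (rho T t)))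

/-- `f : T^κ → F` is rd-continuous: continuous at every right-dense point, with a left-sided limit
at every left-dense point. -/
def RdContinuous (T : Set ℝ) (f : ℝ → F) : Prop :=
  (∀ t ∈ upperKappa T, sigma T t = t → ContinuousWithinAt f (upperKappa T) t) ∧
  (∀ t ∈ upperKappa T, rho T t = t → ∃ l : F, Tendsto f (𝓝[upperKappa T ∩ Iio t] t) (𝓝 l))

/-- The space `C^{1,Δ}_rd(T)`: `u` is `Δ`-differentiable on `T^κ` and `u^Δ` is rd-continuous. -/
def IsC1rd (T : Set ℝ) (u : ℝ → F) : Prop :=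
  (∀ t ∈ upperKappa T, DeltaDifferentiableAt T u t) ∧ RdContinuous T (deltaDeriv T u)

end Derivatives

/-- `U` is a `Δ`-antiderivative of `f`: `U^Δ = f` on `T^κ`. -/
def IsDeltaAntideriv (T : Set ℝ) (f U : ℝ → ℝ) : Prop :=
  ∀ t ∈ upperKappa T, HasDeltaDerivAt T U (f t) t

open Classical in
/-- The Cauchy `Δ`-integral `∫_r^s f(τ) Δτ = U(s) - U(r)`, where `U` is any `Δ`-antiderivative of
`f`. Every rd-continuous `f` has one, unique on `T` up to an additive constant. -/
def deltaIntegral (T : Set ℝ) (f : ℝ → ℝ) (r s : ℝ) : ℝ :=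
  if h : ∃ U : ℝ → ℝ, IsDeltaAntideriv T f U then h.choose s - h.choose r else 0

section Variational

variable {n : ℕ}

/-- The partial gradient `∂L/∂x (x, v, t)`. -/
def gradX (L : EuclideanSpace ℝ (Fin n) → EuclideanSpace ℝ (Fin n) → ℝ → ℝ)
    (x v : EuclideanSpace ℝ (Fin n)) (t : ℝ) : EuclideanSpace ℝ (Fin n) :=
  gradient (fun y => L y v t) x

/-- The partial gradient `∂L/∂v (x, v, t)`. -/
def gradV (L : EuclideanSpace ℝ (Fin n) → EuclideanSpace ℝ (Fin n) → ℝ → ℝ)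
    (x v : EuclideanSpace ℝ (Fin n)) (t : ℝ) : EuclideanSpace ℝ (Fin n) :=
  gradient (fun y => L x y t) v

/-- `L : ℝⁿ × ℝⁿ × T^κ → ℝ` is a Lagrangian: it is continuous, and of class `C¹` in its first two
variables, with partial gradients that are continuous on `ℝⁿ × ℝⁿ × T^κ`. -/
structure IsLagrangian (T : Set ℝ)
    (L : EuclideanSpace ℝ (Fin n) → EuclideanSpace ℝ (Fin n) → ℝ → ℝ) : Prop where
  continuousOn : ContinuousOn
    (fun p : EuclideanSpace ℝ (Fin n) × EuclideanSpace ℝ (Fin n) × ℝ => L p.1 p.2.1 p.2.2)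
    (univ ×ˢ univ ×ˢ upperKappa T)
  contDiff : ∀ t ∈ upperKappa T, ContDiff ℝ 1
    (fun p : EuclideanSpace ℝ (Fin n) × EuclideanSpace ℝ (Fin n) => L p.1 p.2 t)
  continuousOn_gradX : ContinuousOn
    (fun p : EuclideanSpace ℝ (Fin n) × EuclideanSpace ℝ (Fin n) × ℝ => gradX L p.1 p.2.1 p.2.2)
    (univ ×ˢ univ ×ˢ upperKappa T)
  continuousOn_gradV : ContinuousOn
    (fun p : EuclideanSpace ℝ (Fin n) × EuclideanSpace ℝ (Fin n) × ℝ => gradV L p.1 p.2.1 p.2.2)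
    (univ ×ˢ univ ×ˢ upperKappa T)

/-- The non-shifted Lagrangian functional `u ↦ ∫_a^b L(u(τ), u^Δ(τ), τ) Δτ`. -/
def functional (T : Set ℝ) (L : EuclideanSpace ℝ (Fin n) → EuclideanSpace ℝ (Fin n) → ℝ → ℝ)
    (u : ℝ → EuclideanSpace ℝ (Fin n)) : ℝ :=
  deltaIntegral T (fun τ => L (u τ) (deltaDeriv T u τ) τ) (left T) (right T)

/-- `u` is a critical point of the functional: its Gâteaux differential at `u` exists and vanishes
in the direction of every variation `w ∈ C^{1,Δ}_rd(T)` with `w(a) = w(b) = 0`. -/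
def IsCriticalPoint (T : Set ℝ)
    (L : EuclideanSpace ℝ (Fin n) → EuclideanSpace ℝ (Fin n) → ℝ → ℝ)
    (u : ℝ → EuclideanSpace ℝ (Fin n)) : Prop :=
  ∀ w : ℝ → EuclideanSpace ℝ (Fin n), IsC1rd T w → w (left T) = 0 → w (right T) = 0 →
    HasDerivAt (fun ε : ℝ => functional T L (fun τ => u τ + ε • w τ)) 0 0

/-- `u` solves the `∇ ∘ Δ`-differential Euler–Lagrange equation on `T^κ ∩ T_κ`: there
`∂L/∂v (u, u^Δ, ·)` is `∇`-differentiable, with derivative `σ^∇(t) ∂L/∂x (u(t), u^Δ(t), t)`.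
(A point of `T \ T^κ` is isolated in `T`, so the values there of `∂L/∂v (u, u^Δ, ·)`, a function on
`T^κ`, do not enter.) -/
def SolvesEulerLagrange (T : Set ℝ)
    (L : EuclideanSpace ℝ (Fin n) → EuclideanSpace ℝ (Fin n) → ℝ → ℝ)
    (u : ℝ → EuclideanSpace ℝ (Fin n)) : Prop :=
  ∀ t ∈ upperKappa T ∩ lowerKappa T,
    HasNablaDerivAt T (fun s => gradV L (u s) (deltaDeriv T u s) s)
      (nablaDeriv T (sigma T) t • gradX L (u t) (deltaDeriv T u t) t) t

end Variational

end TimeScale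

end

/-! The regularity of `σ` removes the usual difficulties. Being `∇`-differentiable on `T_κ`, it is
continuous on `T`, so right-scattered points are isolated and rd-continuity is plain continuity on
the compact set `T^κ` (`continuousOn_sigma`, `rdContinuous_iff_continuousOn`). For continuous
integrands the `Δ`-integral is integration against the finite measure `deltaMeasure`, so the Gâteaux
differential is found by differentiating under the integral (`hasDerivAt_functional`).

Write `p` and `g` for `∂L/∂v` and `∂L/∂x` along `u`, and let `G` be a `Δ`-antiderivative of `g`. The
Leibniz formula for `⟪G, w⟫` turns the differential into `∫ ⟪p - G ∘ σ, w^Δ⟫ Δτ`. By the du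
Bois-Reymond lemma it vanishes for all admissible `w` exactly when `p - G ∘ σ` is constant on `T^κ`.

The chain rule `(G ∘ σ)^∇ = σ^∇ g` (`HasDeltaDerivAt.comp_sigma`) shows that the differential
equation says precisely that `p - G ∘ σ` has `∇`-derivative zero. For a continuous function this is
constancy, by a mean value argument on compact sets (`eq_of_hasNablaDerivAt_zero`). -/

namespace TimeScale

/-! ### Jump operators and the sets `T^κ`, `T_κ`. -/

section Basics

variable {T : Set ℝ}

theorem nonempty_of_left_lt_right (h : left T < right T) : T.Nonempty := by
  rcases T.eq_empty_or_nonempty with rfl | h'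
  · simp [left, right] at h
  · exact h'

theorem left_lt_right (hT : IsCompact T) (hnt : T.Nontrivial) : left T < right T := by
  obtain ⟨x, hx, y, hy, hxy⟩ := hnt.exists_lt
  exact (csInf_le hT.bddBelow hx).trans_lt (hxy.trans_le (le_csSup hT.bddAbove hy))

theorem left_mem (hT : IsCompact T) (hne : T.Nonempty) : left T ∈ T := hT.sInf_mem hne

theorem right_mem (hT : IsCompact T) (hne : T.Nonempty) : right T ∈ T := hT.sSup_mem hne

theorem left_le (hT : IsCompact T) {t : ℝ} (ht : t ∈ T) : left T ≤ t := csInf_le hT.bddBelow ht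

theorem le_right (hT : IsCompact T) {t : ℝ} (ht : t ∈ T) : t ≤ right T := le_csSup hT.bddAbove ht

theorem bddBelow_gt (T : Set ℝ) (t : ℝ) : BddBelow {s ∈ T | t < s} := ⟨t, fun _ h => h.2.le⟩

theorem bddAbove_lt (T : Set ℝ) (t : ℝ) : BddAbove {s ∈ T | s < t} := ⟨t, fun _ h => h.2.le⟩

theorem sigma_le {s t : ℝ} (hs : s ∈ T) (hts : t < s) : sigma T t ≤ s := by
  have hn : {s ∈ T | t < s}.Nonempty := ⟨s, hs, hts⟩
  rw [sigma, if_pos hn]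
  exact csInf_le (bddBelow_gt T t) ⟨hs, hts⟩

theorem le_rho {s t : ℝ} (hs : s ∈ T) (hts : s < t) : s ≤ rho T t := by
  have hn : {s ∈ T | s < t}.Nonempty := ⟨s, hs, hts⟩
  rw [rho, if_pos hn]
  exact le_csSup (bddAbove_lt T t) ⟨hs, hts⟩

theorem le_sigma (hT : IsCompact T) {t : ℝ} (ht : t ∈ T) : t ≤ sigma T t := by
  rw [sigma]
  split_ifs with hn
  · exact le_csInf hn fun _ h => h.2.le
  · exact le_right hT ht

theorem rho_le (hT : IsCompact T) {t : ℝ} (ht : t ∈ T) : rho T t ≤ t := by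
  rw [rho]
  split_ifs with hn
  · exact csSup_le hn fun _ h => h.2.le
  · exact left_le hT ht

theorem sigma_mem (hT : IsCompact T) (hne : T.Nonempty) (t : ℝ) : sigma T t ∈ T := by
  rw [sigma]
  split_ifs with hn
  · exact hT.isClosed.closure_subset_iff.2 (fun _ h => h.1)
      (csInf_mem_closure hn (bddBelow_gt T t))
  · exact right_mem hT hne

theorem rho_mem (hT : IsCompact T) (hne : T.Nonempty) (t : ℝ) : rho T t ∈ T := by
  rw [rho]
  split_ifs with hn
  · exact hT.isClosed.closure_subset_iff.2 (fun _ h => h.1)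
      (csSup_mem_closure hn (bddAbove_lt T t))
  · exact left_mem hT hne

theorem exists_mem_Ioo_of_sigma_eq {s t z : ℝ} (hs : s ∈ T) (hts : t < s) (hσ : sigma T t = t)
    (hz : t < z) : ∃ x ∈ T, t < x ∧ x < z := by
  have hn : {s ∈ T | t < s}.Nonempty := ⟨s, hs, hts⟩
  have h : sInf {s ∈ T | t < s} < z := by
    have : sigma T t = sInf {s ∈ T | t < s} := by rw [sigma, if_pos hn]
    rw [← this, hσ]; exact hz
  obtain ⟨x, hx, hxz⟩ := exists_lt_of_csInf_lt hn h
  exact ⟨x, hx.1, hx.2, hxz⟩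

theorem exists_mem_Ioo_of_rho_eq {s t z : ℝ} (hs : s ∈ T) (hts : s < t) (hρ : rho T t = t)
    (hz : z < t) : ∃ x ∈ T, x < t ∧ z < x := by
  have hn : {s ∈ T | s < t}.Nonempty := ⟨s, hs, hts⟩
  have h : z < sSup {s ∈ T | s < t} := by
    have : rho T t = sSup {s ∈ T | s < t} := by rw [rho, if_pos hn]
    rw [← this, hρ]; exact hz
  obtain ⟨x, hx, hxz⟩ := exists_lt_of_lt_csSup hn h
  exact ⟨x, hx.1, hx.2, hxz⟩

theorem sigma_rho {t : ℝ} (ht : t ∈ T) (h : rho T t < t) :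
    sigma T (rho T t) = t := by
  have hn : {s ∈ T | rho T t < s}.Nonempty := ⟨t, ht, h⟩
  refine le_antisymm (sigma_le ht h) ?_
  rw [sigma, if_pos hn]
  refine le_csInf hn fun s hs => ?_
  by_contra! hst
  exact (le_rho hs.1 hst).not_gt hs.2

theorem upperKappa_eq (hT : IsCompact T) : upperKappa T = T ∩ Iic (rho T (right T)) := by
  ext t
  simp only [upperKappa, Set.mem_sdiff, mem_Ioc, not_and, not_le, mem_inter_iff, mem_Iic]
  refine and_congr_right fun ht => ⟨fun h => ?_, fun h h' => absurd h h'.not_ge⟩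
  by_contra! h'
  exact (h h').not_ge (le_right hT ht)

theorem lowerKappa_eq (hT : IsCompact T) : lowerKappa T = T ∩ Ici (sigma T (left T)) := by
  ext t
  simp only [lowerKappa, Set.mem_sdiff, mem_Ico, not_and, not_lt, mem_inter_iff, mem_Ici]
  exact and_congr_right fun ht => ⟨fun h => h (left_le hT ht), fun h _ => h⟩

theorem isCompact_upperKappa (hT : IsCompact T) : IsCompact (upperKappa T) := by
  rw [upperKappa_eq hT]
  exact hT.inter_right isClosed_Iic

theorem upperKappa_subset : upperKappa T ⊆ T := sdiff_subset

theorem mem_upperKappa_of_lt (hT : IsCompact T) {t : ℝ} (ht : t ∈ T) (h : t < right T) :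
    t ∈ upperKappa T := by
  rw [upperKappa_eq hT]
  exact ⟨ht, le_rho ht h⟩

theorem mem_lowerKappa_of_lt (hT : IsCompact T) {t : ℝ} (ht : t ∈ T) (h : left T < t) :
    t ∈ lowerKappa T := by
  rw [lowerKappa_eq hT]
  exact ⟨ht, sigma_le ht h⟩

theorem mem_upperKappa_of_le (hT : IsCompact T) {s t : ℝ} (hs : s ∈ T) (ht : t ∈ upperKappa T)
    (h : s ≤ t) : s ∈ upperKappa T := by
  rw [upperKappa_eq hT] at *
  exact ⟨hs, h.trans ht.2⟩

/-- A point of `T` outside `T^κ` is isolated. -/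
theorem nhdsWithin_upperKappa (hT : IsCompact T) {t : ℝ} (ht : t ∈ upperKappa T) :
    𝓝[upperKappa T] t = 𝓝[T] t := by
  refine le_antisymm (nhdsWithin_mono _ upperKappa_subset) ?_
  refine nhdsWithin_le_of_mem ?_
  have htT := upperKappa_subset ht
  rcases (le_right hT htT).eq_or_lt with h | h
  · filter_upwards [self_mem_nhdsWithin] with s hs
    exact mem_upperKappa_of_le hT hs ht (by rw [h]; exact le_right hT hs)
  · filter_upwards [self_mem_nhdsWithin, mem_nhdsWithin_of_mem_nhds (Iio_mem_nhds h)] with s hs hs'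
    exact mem_upperKappa_of_lt hT hs hs'

theorem left_mem_upperKappa (hT : IsCompact T) (hlt : left T < right T) : left T ∈ upperKappa T :=
  mem_upperKappa_of_lt hT (left_mem hT (nonempty_of_left_lt_right hlt)) hlt

/-- The punctured neighbourhoods in the definition of the `Δ`-derivative are nontrivial. -/
theorem neBot_nhdsWithin_sigma (hT : IsCompact T) (hlt : left T < right T) {t : ℝ}
    (ht : t ∈ upperKappa T) : (𝓝[T \ {sigma T t}] t).NeBot := by
  have hne := nonempty_of_left_lt_right hlt
  have htT := upperKappa_subset ht
  rw [← mem_closure_iff_nhdsWithin_neBot]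
  by_cases hσ : sigma T t = t
  · rw [hσ, Metric.mem_closure_iff]
    intro ε hε
    -- The point `b` belongs to `T^κ` only if it is left-dense, so it is approached from the left;
    -- any other right-dense point is approached from the right.
    rcases (le_right hT htT).eq_or_lt with h | h
    · have hρ : rho T t = t := by
        rw [upperKappa_eq hT] at ht
        exact le_antisymm (rho_le hT htT) (by simpa [h] using ht.2)
      obtain ⟨x, hx, h1, h2⟩ := exists_mem_Ioo_of_rho_eq (left_mem hT hne) (h ▸ hlt) hρ
        (sub_lt_self t hε)
      exact ⟨x, ⟨hx, h1.ne⟩, by rw [Real.dist_eq, abs_lt]; constructor <;> linarith⟩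
    · obtain ⟨x, hx, h1, h2⟩ := exists_mem_Ioo_of_sigma_eq (right_mem hT hne) h hσ
        (lt_add_of_pos_right t hε)
      exact ⟨x, ⟨hx, h1.ne'⟩, by rw [Real.dist_eq, abs_lt]; constructor <;> linarith⟩
  · exact subset_closure ⟨htT, fun h => hσ h.symm⟩

/-- Where `σ` is continuous, a right-scattered point is isolated. -/
theorem eventually_eq_of_sigma_ne (hT : IsCompact T) {t : ℝ} (ht : t ∈ T)
    (hσ : ContinuousWithinAt (sigma T) T t) (h : sigma T t ≠ t) : ∀ᶠ s in 𝓝[T] t, s = t := by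
  have hlt : t < sigma T t := lt_of_le_of_ne (le_sigma hT ht) h.symm
  filter_upwards [self_mem_nhdsWithin, hσ.eventually (lt_mem_nhds hlt),
    mem_nhdsWithin_of_mem_nhds (Iio_mem_nhds hlt)] with s hs h1 h2
  rcases lt_trichotomy s t with h | h | h
  · exact absurd (sigma_le ht h) h1.not_ge
  · exact h
  · exact absurd (sigma_le hs h) (not_le.2 h2)

end Basics

/-! ### Both derivatives as limits of slopes based at a jump point. -/

section Slopes

variable {F : Type*} [NormedAddCommGroup F] [NormedSpace ℝ F] {T : Set ℝ} {u : ℝ → F} {u' : F}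
  {t p : ℝ}

theorem hasDeltaDerivAt_iff_slope :
    HasDeltaDerivAt T u u' t ↔
      Tendsto (slope u (sigma T t)) (𝓝[T \ {sigma T t}] t) (𝓝 u') := by
  unfold HasDeltaDerivAt
  refine iff_of_eq (congrArg (fun g => Tendsto g _ _) (funext fun s => ?_))
  rw [slope_comm]
  rfl

theorem hasNablaDerivAt_iff_slope :
    HasNablaDerivAt T u u' t ↔ Tendsto (slope u (rho T t)) (𝓝[T \ {rho T t}] t) (𝓝 u') :=
  Iff.rfl

/-- At a scattered point the base `p` of the slope differs from `t`, so removing `p` does not change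
the neighbourhoods of `t` in `T`. As `t` itself is allowed, the limit must be the value of the slope
at `t`. For `p = t` the limit is an ordinary derivative within `T`. -/
theorem tendsto_slope_iff_of_ne (ht : t ∈ T) (hp : t ≠ p) :
    Tendsto (slope u p) (𝓝[T \ {p}] t) (𝓝 u') ↔
      ContinuousWithinAt u T t ∧ u t - u p = (t - p) • u' := by
  have hmem : t ∈ T \ {p} := ⟨ht, hp⟩
  have hnhds : 𝓝[T \ {p}] t = 𝓝[T] t := nhdsWithin_eq_nhdsWithin (s := {p}ᶜ) hp
    (isOpen_compl_singleton) (by ext; simp [and_comm])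
  have htp : t - p ≠ 0 := sub_ne_zero.2 hp
  rw [hnhds]
  constructor
  · intro h
    have hv : slope u p t = u' :=
      tendsto_nhds_unique (tendsto_pure_nhds _ _) (h.mono_left (pure_le_nhdsWithin ht))
    have hcont : Tendsto (fun s => (s - p) • slope u p s + u p) (𝓝[T] t)
        (𝓝 ((t - p) • u' + u p)) := by
      refine Tendsto.add (Tendsto.smul ?_ h) tendsto_const_nhds
      exact ((continuous_id.sub continuous_const).tendsto t).mono_left nhdsWithin_le_nhds
    have hval : u t - u p = (t - p) • u' := by rw [← hv, sub_smul_slope]; rfl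
    refine ⟨?_, hval⟩
    have h2 : (fun s => (s - p) • slope u p s + u p) = u := by
      funext s; rw [sub_smul_slope]; simp
    rw [h2, ← hval, sub_add_cancel] at hcont
    exact hcont
  · rintro ⟨hc, hv⟩
    have : u' = slope u p t := by
      rw [slope_def_module, hv, smul_smul, inv_mul_cancel₀ htp, one_smul]
    rw [this]
    simp only [slope_fun_def]
    refine Tendsto.smul (Tendsto.inv₀ ?_ htp) (hc.sub_const _)
    exact ((continuous_id.sub continuous_const).tendsto t).mono_left nhdsWithin_le_nhds

theorem continuousWithinAt_of_tendsto_slope (ht : t ∈ T)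
    (h : Tendsto (slope u p) (𝓝[T \ {p}] t) (𝓝 u')) : ContinuousWithinAt u T t := by
  by_cases hp : t = p
  · subst hp
    exact (hasDerivWithinAt_iff_tendsto_slope.2 h).continuousWithinAt
  · exact ((tendsto_slope_iff_of_ne ht hp).1 h).1

theorem sub_eq_of_tendsto_slope (ht : t ∈ T)
    (h : Tendsto (slope u p) (𝓝[T \ {p}] t) (𝓝 u')) : u t - u p = (t - p) • u' := by
  by_cases hp : t = p
  · simp [hp]
  · exact ((tendsto_slope_iff_of_ne ht hp).1 h).2

theorem HasDeltaDerivAt.sub_eq (h : HasDeltaDerivAt T u u' t) (ht : t ∈ T) :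
    u (sigma T t) - u t = (sigma T t - t) • u' := by
  have := sub_eq_of_tendsto_slope ht (hasDeltaDerivAt_iff_slope.1 h)
  rw [← neg_sub, this, ← neg_smul, neg_sub]

theorem HasDeltaDerivAt.continuousWithinAt (h : HasDeltaDerivAt T u u' t) (ht : t ∈ T) :
    ContinuousWithinAt u T t :=
  continuousWithinAt_of_tendsto_slope ht (hasDeltaDerivAt_iff_slope.1 h)

theorem HasDeltaDerivAt.sub {v : ℝ → F} {v' : F} (hu : HasDeltaDerivAt T u u' t)
    (hv : HasDeltaDerivAt T v v' t) : HasDeltaDerivAt T (fun s => u s - v s) (u' - v') t := by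
  refine (Tendsto.sub hu hv).congr fun s => ?_
  rw [← smul_sub, sub_sub_sub_comm]

theorem HasDeltaDerivAt.add_smul {v : ℝ → F} {v' : F} (hu : HasDeltaDerivAt T u u' t)
    (hv : HasDeltaDerivAt T v v' t) (c : ℝ) :
    HasDeltaDerivAt T (fun s => u s + c • v s) (u' + c • v') t := by
  refine (Tendsto.add hu (Tendsto.const_smul hv c)).congr fun s => ?_
  rw [smul_comm c, ← smul_add, smul_sub, add_sub_add_comm]

theorem HasNablaDerivAt.sub {v : ℝ → F} {v' : F} (hu : HasNablaDerivAt T u u' t)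
    (hv : HasNablaDerivAt T v v' t) : HasNablaDerivAt T (fun s => u s - v s) (u' - v') t := by
  refine (Tendsto.sub hu hv).congr fun s => ?_
  rw [← smul_sub, sub_sub_sub_comm]

theorem DeltaDifferentiableAt.hasDeltaDerivAt (h : DeltaDifferentiableAt T u t) :
    HasDeltaDerivAt T u (deltaDeriv T u t) t :=
  tendsto_nhds_limUnder h

theorem NablaDifferentiableAt.hasNablaDerivAt (h : NablaDifferentiableAt T u t) :
    HasNablaDerivAt T u (nablaDeriv T u t) t :=
  tendsto_nhds_limUnder h

theorem HasDeltaDerivAt.deltaDeriv_eq (hT : IsCompact T) (hlt : left T < right T)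
    (ht : t ∈ upperKappa T) (h : HasDeltaDerivAt T u u' t) : deltaDeriv T u t = u' :=
  have := neBot_nhdsWithin_sigma hT hlt ht
  Tendsto.limUnder_eq h

/-- The Leibniz formula `(⟪u, v⟫)^Δ = ⟪u^Δ, v⟫ + ⟪u^σ, v^Δ⟫`. -/
theorem HasDeltaDerivAt.inner {E : Type*} [NormedAddCommGroup E] [InnerProductSpace ℝ E]
    {u v : ℝ → E} {u' v' : E} (ht : t ∈ T) (hu : HasDeltaDerivAt T u u' t)
    (hv : HasDeltaDerivAt T v v' t) :
    HasDeltaDerivAt T (fun s => inner ℝ (u s) (v s))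
      (inner ℝ u' (v t) + inner ℝ (u (sigma T t)) v') t := by
  have hc := (hv.continuousWithinAt ht).mono_left (nhdsWithin_mono t (sdiff_subset (t := {sigma T t})))
  refine ((Tendsto.inner hu hc).add (Tendsto.inner tendsto_const_nhds hv)).congr fun s => ?_
  simp only [inner_smul_left, inner_smul_right, inner_sub_left, inner_sub_right, smul_eq_mul,
    RCLike.conj_to_real]
  ring

end Slopes

/-! ### Mean value inequality on compact sets. -/

section Constancy

variable {F : Type*} [NormedAddCommGroup F] {K : Set ℝ} {q : ℝ → F}

/-- The points of `K ∩ [r, y]` satisfying the bound relative to `r` form a compact set. Its greatest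
element must be `y`, since otherwise the hypothesis produces a larger one. -/
theorem dist_le_of_forall_exists_right (hK : IsCompact K) (hq : ContinuousOn q K) {ε : ℝ}
    (h : ∀ t ∈ K, ∀ y ∈ K, t < y → ∃ x ∈ K, t < x ∧ x ≤ y ∧ ‖q x - q t‖ ≤ ε * (x - t))
    {r y : ℝ} (hr : r ∈ K) (hy : y ∈ K) (hry : r ≤ y) : ‖q y - q r‖ ≤ ε * (y - r) := by
  let S := {x ∈ K ∩ Icc r y | ‖q x - q r‖ ≤ ε * (x - r)}
  have hKI : IsCompact (K ∩ Icc r y) := hK.inter_right isClosed_Icc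
  have hS : IsCompact S := by
    refine hKI.of_isClosed_subset ?_ (fun x hx => hx.1)
    refine hKI.isClosed.isClosed_le ?_ (by fun_prop)
    exact ((hq.mono inter_subset_left).sub continuousOn_const).norm
  obtain ⟨m, hmS, hm⟩ := hS.exists_isGreatest ⟨r, ⟨hr, le_rfl, hry⟩, by simp⟩
  rcases hmS.1.2.2.eq_or_lt with hmy | hmy
  · exact hmy ▸ hmS.2
  obtain ⟨x, hx, hmx, hxy, hle⟩ := h m hmS.1.1 y hy hmy
  refine absurd (hm (a := x) ⟨⟨hx, hmS.1.2.1.trans hmx.le, hxy⟩, ?_⟩) hmx.not_ge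
  calc ‖q x - q r‖ = ‖(q x - q m) + (q m - q r)‖ := by rw [sub_add_sub_cancel]
    _ ≤ ‖q x - q m‖ + ‖q m - q r‖ := norm_add_le _ _
    _ ≤ ε * (x - m) + ε * (m - r) := add_le_add hle hmS.2
    _ = ε * (x - r) := by ring

theorem eq_of_forall_exists_right (hK : IsCompact K) (hq : ContinuousOn q K)
    (h : ∀ ε > 0, ∀ t ∈ K, ∀ y ∈ K, t < y → ∃ x ∈ K, t < x ∧ x ≤ y ∧ ‖q x - q t‖ ≤ ε * (x - t))
    {r y : ℝ} (hr : r ∈ K) (hy : y ∈ K) : q y = q r := by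
  wlog hry : r ≤ y generalizing r y
  · exact (this hy hr (not_le.1 hry).le).symm
  rw [← sub_eq_zero, ← norm_le_zero_iff]
  have hlim : Tendsto (fun ε : ℝ => ε * (y - r)) (𝓝[>] 0) (𝓝 0) := by
    have : Tendsto (fun ε : ℝ => ε * (y - r)) (𝓝 0) (𝓝 (0 * (y - r))) :=
      (continuous_id.mul continuous_const).tendsto 0
    rw [zero_mul] at this
    exact this.mono_left nhdsWithin_le_nhds
  refine ge_of_tendsto hlim ?_
  filter_upwards [self_mem_nhdsWithin] with ε hε
  exact dist_le_of_forall_exists_right hK hq (h ε hε) hr hy hry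

/-- Reflection `x ↦ -x` reduces this to rightward steps. The leftward form suits the `∇`-derivative,
which compares `t` with `ρ(t)`. -/
theorem eq_of_forall_exists_left (hK : IsCompact K) (hq : ContinuousOn q K)
    (h : ∀ ε > 0, ∀ t ∈ K, ∀ y ∈ K, y < t → ∃ x ∈ K, x < t ∧ y ≤ x ∧ ‖q x - q t‖ ≤ ε * (t - x))
    {r y : ℝ} (hr : r ∈ K) (hy : y ∈ K) : q y = q r := by
  have hmem : ∀ {x}, x ∈ K → -x ∈ -K := fun hx => by simpa using hx
  have := eq_of_forall_exists_right (K := -K) (q := fun x => q (-x)) hK.neg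
    (hq.comp continuous_neg.continuousOn fun x hx => hx) (fun ε hε t ht y hy hty => by
      obtain ⟨x, hx, h1, h2, h3⟩ := h ε hε (-t) ht (-y) hy (by linarith)
      refine ⟨-x, hmem hx, by linarith, by linarith, ?_⟩
      rw [neg_neg]
      exact h3.trans_eq (by ring)) (hmem hr) (hmem hy)
  simpa using this

end Constancy

/-! ### Functions with vanishing derivative are constant. -/

section Uniqueness

variable {F : Type*} [NormedAddCommGroup F] [NormedSpace ℝ F] {T : Set ℝ} {u : ℝ → F}

/-- The only point of `T` that can lie outside `T^κ` is a left-scattered `b`, which is isolated. -/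
theorem continuousOn_of_deltaDifferentiable (hT : IsCompact T)
    (h : ∀ t ∈ upperKappa T, DeltaDifferentiableAt T u t) : ContinuousOn u T := by
  intro t ht
  by_cases htK : t ∈ upperKappa T
  · exact (h t htK).choose_spec.continuousWithinAt ht
  · have htb : t = right T := by
      by_contra hne
      exact htK (mem_upperKappa_of_lt hT ht (lt_of_le_of_ne (le_right hT ht) hne))
    have hρ : rho T (right T) < t := by
      rw [upperKappa_eq hT] at htK
      by_contra! hle
      exact htK ⟨ht, hle⟩
    have hev : ∀ᶠ s in 𝓝[T] t, s = t := by
      filter_upwards [self_mem_nhdsWithin, mem_nhdsWithin_of_mem_nhds (Ioi_mem_nhds hρ)]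
        with s hs hs'
      by_contra hne
      have : s < right T := lt_of_le_of_ne (le_right hT hs) (htb ▸ hne)
      exact absurd (le_rho hs this) (not_le.2 hs')
    exact (tendsto_const_nhds (x := u t)).congr' (hev.mono fun s hs => by rw [hs])

/-- A norm bound near `t` from a vanishing derivative within a set. -/
theorem eventually_norm_sub_le {t : ℝ} (h : HasDerivWithinAt u 0 T t) {ε : ℝ} (hε : 0 < ε) :
    ∀ᶠ s in 𝓝[T] t, ‖u s - u t‖ ≤ ε * |s - t| := by
  have := h.hasFDerivWithinAt.isLittleO.def hε
  filter_upwards [this] with s hs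
  simpa using hs

/-- The step to the right goes to a nearby point if `t` is right-dense, and to `σ(t)`, where `u`
takes the same value, if `t` is right-scattered. -/
theorem eq_of_hasDeltaDerivAt_zero (hT : IsCompact T) (hlt : left T < right T)
    (h : ∀ t ∈ upperKappa T, HasDeltaDerivAt T u 0 t) {r s : ℝ} (hr : r ∈ T) (hs : s ∈ T) :
    u s = u r := by
  refine eq_of_forall_exists_right hT
    (continuousOn_of_deltaDifferentiable hT fun t ht => ⟨0, h t ht⟩) ?_ hr hs
  intro ε hε t ht y hy hty
  have htK := mem_upperKappa_of_lt hT ht (hty.trans_le (le_right hT hy))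
  by_cases hσ : sigma T t = t
  · have hd : HasDerivWithinAt u 0 T t := by
      have := hasDeltaDerivAt_iff_slope.1 (h t htK)
      rw [hσ] at this
      exact hasDerivWithinAt_iff_tendsto_slope.2 this
    obtain ⟨δ, hδ, hball⟩ := Metric.mem_nhdsWithin_iff.1 (eventually_norm_sub_le hd hε)
    obtain ⟨x, hx, h1, h2⟩ := exists_mem_Ioo_of_sigma_eq hy hty hσ
      (lt_min hty (lt_add_of_pos_right t hδ))
    have h3 := h2.trans_le (min_le_left _ _)
    have h4 := h2.trans_le (min_le_right _ _)
    refine ⟨x, hx, h1, h3.le, ?_⟩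
    have := hball (a := x) ⟨by rw [Metric.mem_ball, Real.dist_eq, abs_lt]; constructor <;> linarith, hx⟩
    rwa [mem_ofPred_eq, abs_of_pos (sub_pos.2 h1)] at this
  · have hlt' := lt_of_le_of_ne (le_sigma hT ht) (Ne.symm hσ)
    refine ⟨sigma T t, sigma_mem hT (nonempty_of_left_lt_right hlt) t, hlt', sigma_le hy hty, ?_⟩
    rw [(h t htK).sub_eq ht, smul_zero, norm_zero]
    exact mul_nonneg hε.le (sub_nonneg.2 hlt'.le)

/-- Leftward steps never leave `T^κ`, and a point of `T^κ` with another point to its left lies in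
`T_κ`, so the hypothesis applies wherever a step is needed. -/
theorem eq_of_hasNablaDerivAt_zero (hT : IsCompact T) (hlt : left T < right T)
    (hu : ContinuousOn u (upperKappa T))
    (h : ∀ t ∈ upperKappa T ∩ lowerKappa T, HasNablaDerivAt T u 0 t) {r s : ℝ}
    (hr : r ∈ upperKappa T) (hs : s ∈ upperKappa T) : u s = u r := by
  refine eq_of_forall_exists_left (isCompact_upperKappa hT) hu ?_ hr hs
  intro ε hε t htK y hyK hyt
  have ht := upperKappa_subset htK
  have hy := upperKappa_subset hyK
  have hd := hasNablaDerivAt_iff_slope.1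
    (h t ⟨htK, mem_lowerKappa_of_lt hT ht ((left_le hT hy).trans_lt hyt)⟩)
  by_cases hρ : rho T t = t
  · rw [hρ] at hd
    obtain ⟨δ, hδ, hball⟩ := Metric.mem_nhdsWithin_iff.1
      (eventually_norm_sub_le (hasDerivWithinAt_iff_tendsto_slope.2 hd) hε)
    obtain ⟨x, hx, h1, h2⟩ := exists_mem_Ioo_of_rho_eq hy hyt hρ (max_lt hyt (sub_lt_self t hδ))
    have h3 := (le_max_left _ _).trans_lt h2
    have h4 := (le_max_right _ _).trans_lt h2
    refine ⟨x, mem_upperKappa_of_le hT hx htK h1.le, h1, h3.le, ?_⟩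
    have := hball (a := x) ⟨by rw [Metric.mem_ball, Real.dist_eq, abs_lt]; constructor <;> linarith, hx⟩
    rwa [mem_ofPred_eq, abs_sub_comm, abs_of_pos (sub_pos.2 h1)] at this
  · have hlt' := lt_of_le_of_ne (rho_le hT ht) hρ
    refine ⟨rho T t, mem_upperKappa_of_le hT (rho_mem hT (nonempty_of_left_lt_right hlt) t) htK
      hlt'.le, hlt', le_rho hy hyt, ?_⟩
    rw [norm_sub_rev, sub_eq_of_tendsto_slope ht hd, smul_zero, norm_zero]
    exact mul_nonneg hε.le (sub_nonneg.2 hlt'.le)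

end Uniqueness

/-! ### Consequences of the `∇`-differentiability of `σ`. -/

section Regularity

variable {F : Type*} [NormedAddCommGroup F] [NormedSpace ℝ F] {T : Set ℝ}

/-- The only point of `T` that can lie outside `T_κ` is a right-scattered `a`, which is isolated. -/
theorem continuousOn_sigma (hT : IsCompact T)
    (hσ : ∀ t ∈ lowerKappa T, NablaDifferentiableAt T (sigma T) t) :
    ContinuousOn (sigma T) T := by
  intro t ht
  by_cases htK : t ∈ lowerKappa T
  · exact continuousWithinAt_of_tendsto_slope ht
      (hasNablaDerivAt_iff_slope.1 (hσ t htK).hasNablaDerivAt)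
  · have hta : t = left T := by
      by_contra hne
      exact htK (mem_lowerKappa_of_lt hT ht (lt_of_le_of_ne (left_le hT ht) (Ne.symm hne)))
    have hlt : t < sigma T (left T) := by
      rw [lowerKappa_eq hT] at htK
      by_contra! hle
      exact htK ⟨ht, hle⟩
    have hev : ∀ᶠ s in 𝓝[T] t, s = t := by
      filter_upwards [self_mem_nhdsWithin, mem_nhdsWithin_of_mem_nhds (Iio_mem_nhds hlt)]
        with s hs hs'
      by_contra hne
      have : left T < s := lt_of_le_of_ne (left_le hT hs) (hta ▸ Ne.symm hne)
      exact absurd (sigma_le hs this) (not_le.2 hs')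
    exact (tendsto_const_nhds (x := sigma T t)).congr' (hev.mono fun s hs => by rw [hs])

/-- Right-scattered points are isolated once `σ` is continuous, so continuity is in question only at
right-dense points. -/
theorem rdContinuous_iff_continuousOn {F : Type*} [NormedAddCommGroup F] (hT : IsCompact T) (hσ : ContinuousOn (sigma T) T)
    {f : ℝ → F} : RdContinuous T f ↔ ContinuousOn f (upperKappa T) := by
  constructor
  · intro h t htK
    have ht := upperKappa_subset htK
    by_cases hs : sigma T t = t
    · exact h.1 t htK hs
    · have hev := (eventually_eq_of_sigma_ne hT ht (hσ t ht) hs).filter_mono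
        (nhdsWithin_mono t upperKappa_subset)
      exact (tendsto_const_nhds (x := f t)).congr' (hev.mono fun s hs => by rw [hs])
  · intro h
    exact ⟨fun t ht _ => h t ht,
      fun t ht _ => ⟨f t, (h t ht).mono_left (nhdsWithin_mono t inter_subset_left)⟩⟩

theorem isC1rd_of_hasDeltaDerivAt (hT : IsCompact T) (hlt : left T < right T)
    (hσ : ContinuousOn (sigma T) T) {u f : ℝ → F} (hf : ContinuousOn f (upperKappa T))
    (h : ∀ t ∈ upperKappa T, HasDeltaDerivAt T u (f t) t) : IsC1rd T u :=
  ⟨fun t ht => ⟨f t, h t ht⟩, (rdContinuous_iff_continuousOn hT hσ).2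
    (hf.congr fun t ht => (h t ht).deltaDeriv_eq hT hlt ht)⟩

theorem IsC1rd.hasDeltaDerivAt {u : ℝ → F} (h : IsC1rd T u) {t : ℝ} (ht : t ∈ upperKappa T) :
    HasDeltaDerivAt T u (deltaDeriv T u t) t :=
  (h.1 t ht).hasDeltaDerivAt

theorem IsC1rd.continuousOn_deltaDeriv (hT : IsCompact T) (hσ : ContinuousOn (sigma T) T)
    {u : ℝ → F} (h : IsC1rd T u) : ContinuousOn (deltaDeriv T u) (upperKappa T) :=
  (rdContinuous_iff_continuousOn hT hσ).1 h.2

theorem IsC1rd.continuousOn (hT : IsCompact T) {u : ℝ → F}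
    (h : IsC1rd T u) : ContinuousOn u T :=
  continuousOn_of_deltaDifferentiable hT h.1

/-- The chain rule `(g ∘ σ)^∇ = σ^∇ g^Δ`. -/
theorem HasDeltaDerivAt.comp_sigma (hT : IsCompact T) (hlt : left T < right T) {g : ℝ → F}
    {g' : F} {σ' t : ℝ} (hσc : ContinuousOn (sigma T) T) (hgc : ContinuousOn g T)
    (ht : t ∈ lowerKappa T) (hg : HasDeltaDerivAt T g g' t)
    (hσ : HasNablaDerivAt T (sigma T) σ' t) :
    HasNablaDerivAt T (fun s => g (sigma T s)) (σ' • g') t := by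
  have hne := nonempty_of_left_lt_right hlt
  have htT : t ∈ T := ht.1
  have hmaps : MapsTo (sigma T) T T := fun s _ => sigma_mem hT hne s
  rw [hasNablaDerivAt_iff_slope] at *
  by_cases hρ : rho T t = t
  -- A left-dense point is not isolated, hence is right-dense by continuity of `σ`; the ordinary
  -- chain rule then applies.
  · have hσt : sigma T t = t := by
      by_contra hcon
      have hlt' := lt_of_le_of_ne (le_sigma hT htT) (Ne.symm hcon)
      have hta : left T < t := by
        refine lt_of_le_of_ne (left_le hT htT) fun h => ?_
        rw [lowerKappa_eq hT, h] at ht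
        exact ht.2.not_gt hlt'
      obtain ⟨δ, hδ, hball⟩ := Metric.mem_nhdsWithin_iff.1
        (eventually_eq_of_sigma_ne hT htT (hσc t htT) hcon)
      obtain ⟨x, hx, h1, h2⟩ := exists_mem_Ioo_of_rho_eq (left_mem hT hne) hta hρ
        (sub_lt_self t hδ)
      exact h1.ne (hball ⟨by rw [Metric.mem_ball, Real.dist_eq, abs_lt]; constructor <;> linarith,
        hx⟩)
    rw [hρ] at hσ ⊢
    rw [hasDeltaDerivAt_iff_slope, hσt] at hg
    rw [← hasDerivWithinAt_iff_tendsto_slope] at *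
    refine HasDerivWithinAt.scomp t ?_ hσ hmaps
    rwa [hσt]
  -- At a left-scattered point `σ(ρ(t)) = t`, so the increment of `g ∘ σ` from `ρ(t)` to `t` is that
  -- of `g` from `t` to `σ(t)`.
  · have hlt' := lt_of_le_of_ne (rho_le hT htT) hρ
    rw [tendsto_slope_iff_of_ne htT (Ne.symm hρ)] at *
    refine ⟨ContinuousWithinAt.comp (hgc _ (hmaps htT)) (hσc t htT) hmaps, ?_⟩
    have h1 := hσ.2
    rw [sigma_rho htT hlt'] at h1 ⊢
    rw [hg.sub_eq htT, h1, smul_eq_mul, mul_smul]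

end Regularity

/-! ### The `Δ`-integral as a Lebesgue integral. -/

section Integration

open MeasureTheory

variable {F : Type*} [NormedAddCommGroup F] [NormedSpace ℝ F] {T : Set ℝ}

/-- The largest point of `T` that is at most `x` (the left end point, for `x < min T`). -/
noncomputable def lastPoint (T : Set ℝ) (x : ℝ) : ℝ := sSup (T ∩ Iic (max x (left T)))

theorem lastPoint_mem_inter (hT : IsCompact T) (hne : T.Nonempty) (x : ℝ) :
    lastPoint T x ∈ T ∩ Iic (max x (left T)) :=
  (hT.inter_right isClosed_Iic).sSup_mem ⟨left T, left_mem hT hne, mem_Iic.2 (le_max_right _ _)⟩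

theorem le_lastPoint_iff (hT : IsCompact T) (hne : T.Nonempty) {x t : ℝ} (ht : t ∈ T)
    (hx : left T ≤ x) : t ≤ lastPoint T x ↔ t ≤ x := by
  have h := (lastPoint_mem_inter hT hne x).2
  rw [max_eq_left hx] at h
  refine ⟨fun h' => h'.trans h, fun h' => ?_⟩
  exact le_csSup (hT.bddAbove.mono inter_subset_left) ⟨ht, h'.trans (le_max_left _ _)⟩

/-- Truncating at `left T` keeps the sets under the supremum nonempty, so monotonicity, and with it
measurability, holds on all of `ℝ`. -/
theorem monotone_lastPoint (hT : IsCompact T) (hne : T.Nonempty) : Monotone (lastPoint T) :=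
  fun _ _ hxy => csSup_le_csSup (hT.bddAbove.mono inter_subset_left)
    ⟨_, lastPoint_mem_inter hT hne _⟩
    (inter_subset_inter_right _ (Iic_subset_Iic.2 (max_le_max_right _ hxy)))

/-- The measure of the `Δ`-integral: the interval `[t, σ(t)[` is collapsed to its left end point. -/
noncomputable def deltaMeasure (T : Set ℝ) : Measure ℝ :=
  Measure.map (lastPoint T) (volume.restrict (Ico (left T) (right T)))

instance : IsFiniteMeasure (deltaMeasure T) := by
  unfold deltaMeasure
  infer_instance

/-- Collapsing moves no point across a point of `T`, so `[s, t[` is its own preimage within `[a,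
b[`. -/
theorem deltaMeasure_Ico (hT : IsCompact T) (hne : T.Nonempty) {s t : ℝ} (hs : s ∈ T)
    (ht : t ∈ T) : deltaMeasure T (Ico s t) = ENNReal.ofReal (t - s) := by
  rw [deltaMeasure, Measure.map_apply (monotone_lastPoint hT hne).measurable measurableSet_Ico,
    Measure.restrict_apply ((monotone_lastPoint hT hne).measurable measurableSet_Ico)]
  have : lastPoint T ⁻¹' Ico s t ∩ Ico (left T) (right T) = Ico s t := by
    ext x
    simp only [mem_inter_iff, mem_preimage, mem_Ico]
    constructor
    · rintro ⟨⟨h1, h2⟩, h3, -⟩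
      rw [le_lastPoint_iff hT hne hs h3] at h1
      rw [← not_le, le_lastPoint_iff hT hne ht h3, not_le] at h2
      exact ⟨h1, h2⟩
    · rintro ⟨h1, h2⟩
      have h3 := (left_le hT hs).trans h1
      refine ⟨⟨(le_lastPoint_iff hT hne hs h3).2 h1, ?_⟩, h3, h2.trans_le (le_right hT ht)⟩
      rw [← not_le, le_lastPoint_iff hT hne ht h3, not_le]
      exact h2
  rw [this, Real.volume_Ico]

theorem ae_deltaMeasure (hT : IsCompact T) (hne : T.Nonempty) :
    ∀ᵐ τ ∂deltaMeasure T, τ ∈ upperKappa T ∩ Ico (left T) (right T) := by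
  have hmeas : MeasurableSet (upperKappa T ∩ Ico (left T) (right T)) :=
    (isCompact_upperKappa hT).measurableSet.inter measurableSet_Ico
  refine (ae_map_iff (p := (· ∈ upperKappa T ∩ Ico (left T) (right T)))
    (monotone_lastPoint hT hne).measurable.aemeasurable hmeas).2 ?_
  filter_upwards [ae_restrict_mem measurableSet_Ico] with x hx
  have h := lastPoint_mem_inter hT hne x
  rw [max_eq_left hx.1] at h
  have hlt : lastPoint T x < right T := lt_of_le_of_lt h.2 hx.2
  exact ⟨mem_upperKappa_of_lt hT h.1 hlt, left_le hT h.1, hlt⟩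

theorem deltaMeasure_restrict_upperKappa (hT : IsCompact T) (hne : T.Nonempty) :
    (deltaMeasure T).restrict (upperKappa T) = deltaMeasure T :=
  Measure.restrict_eq_self_of_ae_mem ((ae_deltaMeasure hT hne).mono fun _ h => h.1)

theorem integrable_deltaMeasure {F : Type*} [NormedAddCommGroup F] (hT : IsCompact T) (hne : T.Nonempty) {f : ℝ → F}
    (hf : ContinuousOn f (upperKappa T)) : Integrable f (deltaMeasure T) := by
  have := hf.integrableOn_compact (μ := deltaMeasure T) (isCompact_upperKappa hT)
  rwa [IntegrableOn, deltaMeasure_restrict_upperKappa hT hne] at this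

/-- The antiderivative `t ↦ ∫_a^t f(τ) Δτ`. -/
noncomputable def primitive (T : Set ℝ) (f : ℝ → F) (t : ℝ) : F := ∫ τ in Iio t, f τ ∂deltaMeasure T

theorem primitive_left (hT : IsCompact T) (hne : T.Nonempty) (f : ℝ → F) :
    primitive T f (left T) = 0 := by
  have : deltaMeasure T (Iio (left T)) = 0 :=
    measure_eq_zero_iff_ae_notMem.2
      ((ae_deltaMeasure hT hne).mono fun τ h h' => h.2.1.not_gt h')
  rw [primitive, Measure.restrict_eq_zero.2 this, integral_zero_measure]

theorem primitive_right (hT : IsCompact T) (hne : T.Nonempty) (f : ℝ → F) :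
    primitive T f (right T) = ∫ τ, f τ ∂deltaMeasure T := by
  have : ∀ᵐ τ ∂deltaMeasure T, τ ∈ Iio (right T) :=
    (ae_deltaMeasure hT hne).mono fun τ h => h.2.2
  rw [primitive, Measure.restrict_eq_self_of_ae_mem this]

/-- Intervals are closed on the left and open on the right, so the atom at a right-scattered `t` is
counted between `t` and `σ(t)`. -/
theorem primitive_sub (hT : IsCompact T) (hne : T.Nonempty) {f : ℝ → F}
    (hf : ContinuousOn f (upperKappa T)) {s t : ℝ} (hst : s ≤ t) :
    primitive T f t - primitive T f s = ∫ τ in Ico s t, f τ ∂deltaMeasure T := by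
  have hi := integrable_deltaMeasure hT hne hf
  have hd : Disjoint (Iio s) (Ico s t) :=
    Set.disjoint_left.2 fun x h1 h2 => (mem_Iio.1 h1).not_ge h2.1
  rw [primitive, primitive, ← Iio_union_Ico_eq_Iio hst,
    setIntegral_union hd measurableSet_Ico hi.integrableOn hi.integrableOn, add_sub_cancel_left]

/-- The strict bound `τ < max s t` matters: `f` need not be close to `c` at the upper end point,
which may be the far side `σ(t)` of a gap. -/
theorem norm_primitive_sub_le [CompleteSpace F] (hT : IsCompact T) (hne : T.Nonempty) {f : ℝ → F}
    (hf : ContinuousOn f (upperKappa T)) {s t : ℝ} (hs : s ∈ T) (ht : t ∈ T) {c : F} {ε : ℝ}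
    (h : ∀ τ ∈ upperKappa T, τ ∈ uIcc s t → τ < max s t → ‖f τ - c‖ ≤ ε) :
    ‖primitive T f t - primitive T f s - (t - s) • c‖ ≤ ε * |t - s| := by
  wlog hst : s ≤ t generalizing s t
  · have := this ht hs (by rwa [uIcc_comm, max_comm]) (not_le.1 hst).le
    have hneg : primitive T f t - primitive T f s - (t - s) • c
        = -(primitive T f s - primitive T f t - (s - t) • c) := by
      rw [← neg_sub t s, neg_smul]
      abel
    rwa [abs_sub_comm, hneg, norm_neg]
  rw [uIcc_of_le hst, max_eq_right hst] at h
  have hi := integrable_deltaMeasure hT hne hf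
  have hμ : (deltaMeasure T).real (Ico s t) = t - s := by
    rw [Measure.real, deltaMeasure_Ico hT hne hs ht, ENNReal.toReal_ofReal (sub_nonneg.2 hst)]
  have hsub : primitive T f t - primitive T f s - (t - s) • c
      = ∫ τ in Ico s t, (f τ - c) ∂deltaMeasure T := by
    rw [integral_sub hi.integrableOn (integrable_const c), setIntegral_const, hμ,
      primitive_sub hT hne hf hst]
  rw [hsub, abs_of_nonneg (sub_nonneg.2 hst), ← hμ]
  refine norm_setIntegral_le_of_norm_le_const_ae' (measure_lt_top _ _) ?_
  filter_upwards [ae_deltaMeasure hT hne] with τ hτ hτ'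
  exact h τ hτ.1 (Ico_subset_Icc_self hτ') hτ'.2

theorem hasDeltaDerivAt_primitive [CompleteSpace F] (hT : IsCompact T) (hne : T.Nonempty)
    {f : ℝ → F} (hf : ContinuousOn f (upperKappa T)) {t : ℝ} (ht : t ∈ upperKappa T) :
    HasDeltaDerivAt T (primitive T f) (f t) t := by
  have htT := upperKappa_subset ht
  refine Metric.tendsto_nhds.2 fun ε hε => ?_
  obtain ⟨δ, hδ, hball⟩ := Metric.continuousWithinAt_iff.1 (hf t ht) (ε / 2) (half_pos hε)
  -- If `t` is right-scattered, points near it stay below `σ(t)`.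
  have hgap : ∀ᶠ s in 𝓝 t, t < sigma T t → s < sigma T t := by
    by_cases h : t < sigma T t
    · exact (eventually_lt_nhds h).mono fun s hs _ => hs
    · exact Eventually.of_forall fun s h' => absurd h' h
  filter_upwards [self_mem_nhdsWithin, mem_nhdsWithin_of_mem_nhds (Metric.ball_mem_nhds t hδ),
    mem_nhdsWithin_of_mem_nhds hgap] with s hs hsδ hsgap
  have hσ : t ≤ sigma T t := le_sigma hT htT
  have key := norm_primitive_sub_le hT hne hf hs.1 (sigma_mem hT hne t) (c := f t) (ε := ε / 2) (by
    intro τ hτ hτ1 hτ2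
    have hτT := upperKappa_subset hτ
    -- No point of `T` lies strictly between `t` and `σ(t)`, so the points `τ` that carry weight are
    -- no farther from `t` than `s` is.
    have hle : |τ - t| ≤ |s - t| := by
      rcases le_total s (sigma T t) with h | h
      · rw [uIcc_of_le h] at hτ1
        rw [max_eq_right h] at hτ2
        have : τ ≤ t := by
          by_contra! hcon
          exact (sigma_le hτT hcon).not_gt hτ2
        rw [abs_sub_comm τ, abs_sub_comm s, abs_of_nonneg (by linarith),
          abs_of_nonneg (by linarith [hτ1.1])]
        linarith [hτ1.1]
      · rw [uIcc_of_ge h] at hτ1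
        have : sigma T t = t := by
          by_contra hcon
          exact (hsgap (lt_of_le_of_ne hσ (Ne.symm hcon))).not_ge h
        rw [this] at hτ1 h
        rw [abs_of_nonneg (by linarith [hτ1.1]), abs_of_nonneg (by linarith)]
        linarith [hτ1.2]
    have hτδ : dist τ t < δ := by
      rw [Real.dist_eq]
      exact hle.trans_lt (by simpa [Real.dist_eq] using hsδ)
    rw [← dist_eq_norm]
    exact (hball hτ hτδ).le)
  have hne' : sigma T t - s ≠ 0 := sub_ne_zero.2 fun h => hs.2 h.symm
  have heq : (sigma T t - s)⁻¹ • (primitive T f (sigma T t) - primitive T f s) - f t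
      = (sigma T t - s)⁻¹ • (primitive T f (sigma T t) - primitive T f s
        - (sigma T t - s) • f t) := by
    rw [smul_sub _ _ ((sigma T t - s) • f t), smul_smul, inv_mul_cancel₀ hne', one_smul]
  rw [dist_eq_norm, heq, norm_smul, norm_inv, Real.norm_eq_abs]
  calc |sigma T t - s|⁻¹ * _ ≤ |sigma T t - s|⁻¹ * (ε / 2 * |sigma T t - s|) := by gcongr
    _ = ε / 2 := by
      have : |sigma T t - s| ≠ 0 := abs_ne_zero.2 hne'
      field_simp
    _ < ε := half_lt_self hε

/-- The fundamental theorem of calculus for the `Δ`-integral. -/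
theorem integral_deltaMeasure_eq_sub [CompleteSpace F] (hT : IsCompact T)
    (hlt : left T < right T) {f U : ℝ → F} (hf : ContinuousOn f (upperKappa T))
    (hU : ∀ t ∈ upperKappa T, HasDeltaDerivAt T U (f t) t) :
    ∫ τ, f τ ∂deltaMeasure T = U (right T) - U (left T) := by
  have hne := nonempty_of_left_lt_right hlt
  have h := eq_of_hasDeltaDerivAt_zero (u := fun s => U s - primitive T f s) hT hlt
    (fun t ht => by simpa using (hU t ht).sub (hasDeltaDerivAt_primitive hT hne hf ht))
    (left_mem hT hne) (right_mem hT hne)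
  rw [primitive_left hT hne, primitive_right hT hne, sub_zero] at h
  rw [← h, sub_sub_cancel]

theorem deltaIntegral_eq_integral (hT : IsCompact T) (hlt : left T < right T) {f : ℝ → ℝ}
    (hf : ContinuousOn f (upperKappa T)) :
    deltaIntegral T f (left T) (right T) = ∫ τ, f τ ∂deltaMeasure T := by
  have hne := nonempty_of_left_lt_right hlt
  have h : ∃ U : ℝ → ℝ, IsDeltaAntideriv T f U :=
    ⟨primitive T f, fun t ht => hasDeltaDerivAt_primitive hT hne hf ht⟩
  rw [deltaIntegral, dif_pos h]
  exact (integral_deltaMeasure_eq_sub hT hlt hf h.choose_spec).symm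

/-- The primitive of `f` is monotone and vanishes at both end points, hence on `T`, and `f` is its
`Δ`-derivative. This reaches every point of `T^κ`, including a left-dense `b`, which has measure
zero. -/
theorem eq_zero_of_integral_deltaMeasure_eq_zero (hT : IsCompact T) (hlt : left T < right T)
    {f : ℝ → ℝ} (hf : ContinuousOn f (upperKappa T)) (hpos : ∀ t ∈ upperKappa T, 0 ≤ f t)
    (hint : ∫ τ, f τ ∂deltaMeasure T = 0) {t : ℝ} (ht : t ∈ upperKappa T) : f t = 0 := by
  have hne := nonempty_of_left_lt_right hlt
  have hmono : Monotone (primitive T f) := fun r s hrs => by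
    rw [← sub_nonneg, primitive_sub hT hne hf hrs]
    exact integral_nonneg_of_ae (ae_restrict_of_ae
      ((ae_deltaMeasure hT hne).mono fun τ hτ => hpos τ hτ.1))
  have hzero : ∀ s ∈ T, primitive T f s = 0 := fun s hs => le_antisymm
    (((hmono (le_right hT hs)).trans_eq (primitive_right hT hne f)).trans_eq hint)
    ((primitive_left hT hne f).symm.trans_le (hmono (left_le hT hs)))
  have hd := hasDeltaDerivAt_primitive hT hne hf ht
  have := neBot_nhdsWithin_sigma hT hlt ht
  refine tendsto_nhds_unique (hd.congr' ?_) tendsto_const_nhds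
  filter_upwards [self_mem_nhdsWithin] with s hs
  rw [hzero s hs.1, hzero _ (sigma_mem hT hne t), sub_zero, smul_zero]

end Integration

/-! ### First variation and the du Bois-Reymond lemma. -/

section Variation

open MeasureTheory

variable {T : Set ℝ} {n : ℕ}
  {L : EuclideanSpace ℝ (Fin n) → EuclideanSpace ℝ (Fin n) → ℝ → ℝ}
  {u w : ℝ → EuclideanSpace ℝ (Fin n)}

/-- The partial gradients are the joint derivative in `(x, v)` restricted to the two factors; the
chain rule along a line does the rest. -/
theorem IsLagrangian.hasDerivAt_line (hL : IsLagrangian T L) {t : ℝ} (ht : t ∈ upperKappa T)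
    (x v h k : EuclideanSpace ℝ (Fin n)) (ε : ℝ) :
    HasDerivAt (fun ε : ℝ => L (x + ε • h) (v + ε • k) t)
      (inner ℝ (gradX L (x + ε • h) (v + ε • k) t) h
        + inner ℝ (gradV L (x + ε • h) (v + ε • k) t) k) ε := by
  have hf := fun p => ((hL.contDiff t ht).differentiable one_ne_zero p).hasFDerivAt
  have hX : ∀ x v, inner ℝ (gradX L x v t) h = fderiv ℝ
      (fun p : EuclideanSpace ℝ (Fin n) × EuclideanSpace ℝ (Fin n) => L p.1 p.2 t) (x, v) (h, 0) := by
    intro x v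
    have h1 : HasFDerivAt (fun y => L y v t) _ x :=
      HasFDerivAt.comp (f := fun y => (y, v)) x (hf (x, v)) (hasFDerivAt_prodMk_left x v)
    rw [gradX, gradient, InnerProductSpace.toDual_symm_apply, h1.fderiv]
    simp
  have hV : ∀ x v, inner ℝ (gradV L x v t) k = fderiv ℝ
      (fun p : EuclideanSpace ℝ (Fin n) × EuclideanSpace ℝ (Fin n) => L p.1 p.2 t) (x, v) (0, k) := by
    intro x v
    have h1 : HasFDerivAt (fun y => L x y t) _ v :=
      HasFDerivAt.comp (f := fun y => (x, y)) v (hf (x, v)) (hasFDerivAt_prodMk_right x v)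
    rw [gradV, gradient, InnerProductSpace.toDual_symm_apply, h1.fderiv]
    simp
  rw [hX, hV, ← map_add, Prod.mk_add_mk, add_zero, zero_add]
  have hline : ∀ y z : EuclideanSpace ℝ (Fin n), HasDerivAt (fun ε : ℝ => y + ε • z) z ε := by
    intro y z
    simpa using ((hasDerivAt_id ε).smul_const z).const_add y
  exact (hf (x + ε • h, v + ε • k)).comp_hasDerivAt ε ((hline x h).prodMk (hline v k))

theorem continuousOn_along {G : Type*} [TopologicalSpace G]
    {g : EuclideanSpace ℝ (Fin n) → EuclideanSpace ℝ (Fin n) → ℝ → G}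
    (hg : ContinuousOn (fun p : EuclideanSpace ℝ (Fin n) × EuclideanSpace ℝ (Fin n) × ℝ =>
      g p.1 p.2.1 p.2.2) (univ ×ˢ univ ×ˢ upperKappa T))
    {X V : ℝ × ℝ → EuclideanSpace ℝ (Fin n)} {S : Set ℝ}
    (hX : ContinuousOn X (S ×ˢ upperKappa T)) (hV : ContinuousOn V (S ×ˢ upperKappa T)) :
    ContinuousOn (fun p : ℝ × ℝ => g (X p) (V p) p.2) (S ×ˢ upperKappa T) :=
  hg.comp (hX.prodMk (hV.prodMk continuousOn_snd)) fun _ hp => ⟨mem_univ _, mem_univ _, hp.2⟩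

/-- The `ε`-derivative `D` of the integrand is continuous on the compact set `[-1, 1] × T^κ`, hence
bounded there by a constant, which is integrable for the finite measure `deltaMeasure T`. -/
theorem hasDerivAt_functional (hT : IsCompact T) (hlt : left T < right T)
    (hσ : ContinuousOn (sigma T) T) (hL : IsLagrangian T L) (hu : IsC1rd T u) (hw : IsC1rd T w) :
    HasDerivAt (fun ε : ℝ => functional T L (fun τ => u τ + ε • w τ))
      (∫ τ, (inner ℝ (gradX L (u τ) (deltaDeriv T u τ) τ) (w τ)
        + inner ℝ (gradV L (u τ) (deltaDeriv T u τ) τ) (deltaDeriv T w τ)) ∂deltaMeasure T) 0 := by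
  have hne := nonempty_of_left_lt_right hlt
  have hK := isCompact_upperKappa hT
  set X : ℝ × ℝ → EuclideanSpace ℝ (Fin n) := fun p => u p.2 + p.1 • w p.2
  set V : ℝ × ℝ → EuclideanSpace ℝ (Fin n) :=
    fun p => deltaDeriv T u p.2 + p.1 • deltaDeriv T w p.2
  have hsnd : MapsTo (Prod.snd : ℝ × ℝ → ℝ) (univ ×ˢ upperKappa T) (upperKappa T) :=
    fun _ hp => hp.2
  have hlift : ∀ {f : ℝ → EuclideanSpace ℝ (Fin n)}, ContinuousOn f (upperKappa T) →
      ContinuousOn (fun p : ℝ × ℝ => f p.2) (univ ×ˢ upperKappa T) :=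
    fun hf => hf.comp continuousOn_snd hsnd
  have hu0 := (hu.continuousOn hT).mono upperKappa_subset
  have hw0 := (hw.continuousOn hT).mono upperKappa_subset
  have hu1 := hu.continuousOn_deltaDeriv hT hσ
  have hw1 := hw.continuousOn_deltaDeriv hT hσ
  have hX : ContinuousOn X (univ ×ˢ upperKappa T) :=
    (hlift hu0).add (continuousOn_fst.smul (hlift hw0))
  have hV : ContinuousOn V (univ ×ˢ upperKappa T) :=
    (hlift hu1).add (continuousOn_fst.smul (hlift hw1))
  have hslice : ∀ {G : Type} [TopologicalSpace G] {f : ℝ × ℝ → G} (ε : ℝ),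
      ContinuousOn f (univ ×ˢ upperKappa T) → ContinuousOn (fun τ => f (ε, τ)) (upperKappa T) :=
    fun ε hf => hf.comp (by fun_prop) fun τ hτ => ⟨mem_univ _, hτ⟩
  have hF := continuousOn_along hL.continuousOn hX hV
  set D : ℝ × ℝ → ℝ := fun p => inner ℝ (gradX L (X p) (V p) p.2) (w p.2)
    + inner ℝ (gradV L (X p) (V p) p.2) (deltaDeriv T w p.2)
  have hD : ContinuousOn D (univ ×ˢ upperKappa T) :=
    ((continuousOn_along hL.continuousOn_gradX hX hV).inner (hlift hw0)).add
      ((continuousOn_along hL.continuousOn_gradV hX hV).inner (hlift hw1))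
  have hfun : ∀ ε : ℝ, functional T L (fun τ => u τ + ε • w τ)
      = ∫ τ, L (X (ε, τ)) (V (ε, τ)) τ ∂deltaMeasure T := by
    intro ε
    have heq : EqOn (fun τ => L (u τ + ε • w τ) (deltaDeriv T (fun τ => u τ + ε • w τ) τ) τ)
        (fun τ => L (X (ε, τ)) (V (ε, τ)) τ) (upperKappa T) := by
      intro τ hτ
      have := ((hu.hasDeltaDerivAt hτ).add_smul (hw.hasDeltaDerivAt hτ) ε).deltaDeriv_eq hT hlt hτ
      simp only [this, X, V]
    rw [functional, deltaIntegral_eq_integral hT hlt ((hslice ε hF).congr heq)]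
    exact integral_congr_ae ((ae_deltaMeasure hT hne).mono fun τ hτ => heq hτ.1)
  simp only [hfun]
  obtain ⟨C, hC⟩ := (isCompact_Icc.prod hK).exists_bound_of_continuousOn
    (hD.mono (prod_mono_left (subset_univ (Icc (-1 : ℝ) 1))))
  have hint := fun ε => integrable_deltaMeasure hT hne (hslice ε hF)
  have key := (hasDerivAt_integral_of_dominated_loc_of_deriv_le (μ := deltaMeasure T)
    (F := fun ε τ => L (X (ε, τ)) (V (ε, τ)) τ) (F' := fun ε τ => D (ε, τ)) (x₀ := (0 : ℝ))
    (bound := fun _ => C) (Icc_mem_nhds (a := -1) (b := 1) (by norm_num) (by norm_num))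
    (Eventually.of_forall fun ε => (hint ε).aestronglyMeasurable) (hint 0)
    (integrable_deltaMeasure hT hne (hslice 0 hD)).aestronglyMeasurable
    ((ae_deltaMeasure hT hne).mono fun τ hτ ε hε => hC (ε, τ) ⟨hε, hτ.1⟩) (integrable_const C)
    ((ae_deltaMeasure hT hne).mono fun τ hτ ε _ => 
      hL.hasDerivAt_line hτ.1 (u τ) (deltaDeriv T u τ) (w τ) (deltaDeriv T w τ) ε)).2
  simpa [D, X, V] using key

/-- Integration by parts: `∫ ⟪g, w⟫ Δτ = -∫ ⟪G ∘ σ, w^Δ⟫ Δτ` for an antiderivative `G` of `g` and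
a variation `w` that vanishes at both end points. -/
theorem integral_inner_add_inner_eq (hT : IsCompact T) (hlt : left T < right T)
    (hσ : ContinuousOn (sigma T) T) {g p G : ℝ → EuclideanSpace ℝ (Fin n)}
    (hg : ContinuousOn g (upperKappa T)) (hp : ContinuousOn p (upperKappa T))
    (hG : ∀ t ∈ upperKappa T, HasDeltaDerivAt T G (g t) t) (hw : IsC1rd T w)
    (hwl : w (left T) = 0) (hwr : w (right T) = 0) :
    ∫ τ, (inner ℝ (g τ) (w τ) + inner ℝ (p τ) (deltaDeriv T w τ)) ∂deltaMeasure T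
      = ∫ τ, inner ℝ (p τ - G (sigma T τ)) (deltaDeriv T w τ) ∂deltaMeasure T := by
  have hne := nonempty_of_left_lt_right hlt
  have hw0 := (hw.continuousOn hT).mono upperKappa_subset
  have hw1 := hw.continuousOn_deltaDeriv hT hσ
  have hGσ : ContinuousOn (fun τ => G (sigma T τ)) (upperKappa T) :=
    (continuousOn_of_deltaDifferentiable hT fun t ht => ⟨_, hG t ht⟩).comp
      (hσ.mono upperKappa_subset) fun τ _ => sigma_mem hT hne τ
  have hparts := integral_deltaMeasure_eq_sub hT hlt ((hg.inner hw0).add (hGσ.inner hw1))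
    fun t ht => (hG t ht).inner (upperKappa_subset ht) (hw.hasDeltaDerivAt ht)
  rw [hwl, hwr, inner_zero_right, inner_zero_right, sub_zero] at hparts
  have hi := fun {f : ℝ → ℝ} (hf : ContinuousOn f (upperKappa T)) =>
    integrable_deltaMeasure hT hne hf
  have h1 : ContinuousOn (fun τ => (inner ℝ (g τ) (w τ) : ℝ)
      + inner ℝ (p τ) (deltaDeriv T w τ)) (upperKappa T) := (hg.inner hw0).add (hp.inner hw1)
  have h2 : ContinuousOn (fun τ => (inner ℝ (p τ - G (sigma T τ)) (deltaDeriv T w τ) : ℝ))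
      (upperKappa T) := (hp.sub hGσ).inner hw1
  rw [← sub_eq_zero, ← integral_sub (hi h1) (hi h2), ← hparts]
  congr 1
  funext τ
  simp only [inner_sub_left]
  ring

/-- The du Bois-Reymond lemma. -/
theorem forall_integral_inner_deltaDeriv_eq_zero_iff (hT : IsCompact T) (hlt : left T < right T)
    (hσ : ContinuousOn (sigma T) T) {q : ℝ → EuclideanSpace ℝ (Fin n)}
    (hq : ContinuousOn q (upperKappa T)) :
    (∀ w : ℝ → EuclideanSpace ℝ (Fin n), IsC1rd T w → w (left T) = 0 → w (right T) = 0 →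
      ∫ τ, inner ℝ (q τ) (deltaDeriv T w τ) ∂deltaMeasure T = 0) ↔
    ∃ c, ∀ t ∈ upperKappa T, q t = c := by
  have hne := nonempty_of_left_lt_right hlt
  have hi := fun {f : ℝ → ℝ} (hf : ContinuousOn f (upperKappa T)) =>
    integrable_deltaMeasure hT hne hf
  have hconst : ∀ w : ℝ → EuclideanSpace ℝ (Fin n), IsC1rd T w → w (left T) = 0 →
      w (right T) = 0 → ∀ c, ∫ τ, inner ℝ c (deltaDeriv T w τ) ∂deltaMeasure T = 0 := by
    intro w hw hwl hwr c
    have hw1 := hw.continuousOn_deltaDeriv hT hσ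
    rw [integral_inner (integrable_deltaMeasure hT hne hw1),
      integral_deltaMeasure_eq_sub hT hlt hw1 fun t ht => hw.hasDeltaDerivAt ht, hwl, hwr, sub_zero,
      inner_zero_right]
  constructor
  · intro h
    have hba : right T - left T ≠ 0 := (sub_pos.2 hlt).ne'
    -- With `c` the mean value of `q`, the primitive `w` of `q - c` vanishes at both end points.
    -- Testing with it, and using `∫ ⟪c, w^Δ⟫ = 0`, gives `∫ ⟪q - c, q - c⟫ = 0`.
    set c := (right T - left T)⁻¹ • ∫ τ, q τ ∂deltaMeasure T
    have hqc : ContinuousOn (fun τ => q τ - c) (upperKappa T) := hq.sub continuousOn_const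
    have hwd := fun t (ht : t ∈ upperKappa T) => hasDeltaDerivAt_primitive hT hne hqc ht
    have hw := isC1rd_of_hasDeltaDerivAt hT hlt hσ hqc hwd
    have hw1 := hw.continuousOn_deltaDeriv hT hσ
    have hwl := primitive_left hT hne (fun τ => q τ - c)
    have hmass : (deltaMeasure T).real univ = right T - left T := by
      rw [Measure.real, ← Measure.restrict_apply_univ, Measure.restrict_univ,
        ← measure_congr (s := Ico (left T) (right T)) (eventuallyEq_univ.2
          ((ae_deltaMeasure hT hne).mono fun τ hτ => hτ.2)),
        deltaMeasure_Ico hT hne (left_mem hT hne) (right_mem hT hne),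
        ENNReal.toReal_ofReal (sub_pos.2 hlt).le]
    have hwr : primitive T (fun τ => q τ - c) (right T) = 0 := by
      rw [primitive_right hT hne, integral_sub (integrable_deltaMeasure hT hne hq)
        (integrable_const c), integral_const, hmass, smul_smul, mul_inv_cancel₀ hba, one_smul,
        sub_self]
    have hzero := h _ hw hwl hwr
    have hzero' := hconst _ hw hwl hwr c
    refine ⟨c, fun t ht => ?_⟩
    have hsq : ContinuousOn (fun τ => inner ℝ (q τ - c) (q τ - c)) (upperKappa T) := hqc.inner hqc
    have hint : ∫ τ, inner ℝ (q τ - c) (q τ - c) ∂deltaMeasure T = 0 := by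
      have hsub := integral_sub (hi (hq.inner hw1)) (hi (continuousOn_const (c := c).inner hw1))
      rw [hzero, hzero', sub_zero] at hsub
      rw [← hsub]
      refine integral_congr_ae ((ae_deltaMeasure hT hne).mono fun τ hτ => ?_)
      simp only [(hwd τ hτ.1).deltaDeriv_eq hT hlt hτ.1, ← inner_sub_left]
    have := eq_zero_of_integral_deltaMeasure_eq_zero hT hlt hsq
      (fun _ _ => real_inner_self_nonneg) hint ht
    exact sub_eq_zero.1 (inner_self_eq_zero.1 this)
  · rintro ⟨c, hc⟩ w hw hwl hwr
    rw [← hconst w hw hwl hwr c]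
    exact integral_congr_ae ((ae_deltaMeasure hT hne).mono fun τ hτ => by simp only [hc τ hτ.1])

end Variation

/-! ### Integral and differential forms of the Euler–Lagrange equation. -/

section EulerLagrange

variable {T : Set ℝ} {n : ℕ}
  {L : EuclideanSpace ℝ (Fin n) → EuclideanSpace ℝ (Fin n) → ℝ → ℝ}
  {u : ℝ → EuclideanSpace ℝ (Fin n)}

/-- The Euler–Lagrange equation in integral form. -/
theorem isCriticalPoint_iff_exists_const (hT : IsCompact T) (hlt : left T < right T)
    (hσ : ContinuousOn (sigma T) T) (hL : IsLagrangian T L) (hu : IsC1rd T u)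
    {G : ℝ → EuclideanSpace ℝ (Fin n)}
    (hg : ContinuousOn (fun t => gradX L (u t) (deltaDeriv T u t) t) (upperKappa T))
    (hp : ContinuousOn (fun t => gradV L (u t) (deltaDeriv T u t) t) (upperKappa T))
    (hq : ContinuousOn (fun t => gradV L (u t) (deltaDeriv T u t) t - G (sigma T t)) (upperKappa T))
    (hG : ∀ t ∈ upperKappa T, HasDeltaDerivAt T G (gradX L (u t) (deltaDeriv T u t) t) t) :
    IsCriticalPoint T L u ↔
      ∃ c, ∀ t ∈ upperKappa T, gradV L (u t) (deltaDeriv T u t) t - G (sigma T t) = c := by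
  rw [← forall_integral_inner_deltaDeriv_eq_zero_iff hT hlt hσ hq]
  refine forall_congr' fun w => forall_congr' fun hw => forall_congr' fun hwl =>
    forall_congr' fun hwr => ?_
  have hd := hasDerivAt_functional hT hlt hσ hL hu hw
  rw [integral_inner_add_inner_eq hT hlt hσ hg hp hG hw hwl hwr] at hd
  -- The Gâteaux derivative always exists, so criticality only concerns its value.
  exact ⟨fun h => hd.unique h, fun h => h ▸ hd⟩

/-- By the chain rule the right-hand side of the equation is the `∇`-derivative of `G ∘ σ`. -/
theorem exists_const_iff_solvesEulerLagrange (hT : IsCompact T) (hlt : left T < right T)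
    (hσ : ∀ t ∈ lowerKappa T, NablaDifferentiableAt T (sigma T) t)
    {G : ℝ → EuclideanSpace ℝ (Fin n)}
    (hq : ContinuousOn (fun t => gradV L (u t) (deltaDeriv T u t) t - G (sigma T t)) (upperKappa T))
    (hG : ∀ t ∈ upperKappa T, HasDeltaDerivAt T G (gradX L (u t) (deltaDeriv T u t) t) t) :
    (∃ c, ∀ t ∈ upperKappa T, gradV L (u t) (deltaDeriv T u t) t - G (sigma T t) = c) ↔
      SolvesEulerLagrange T L u := by
  have hne := nonempty_of_left_lt_right hlt
  have hGσ : ∀ t ∈ upperKappa T ∩ lowerKappa T, HasNablaDerivAt T (fun s => G (sigma T s))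
      (nablaDeriv T (sigma T) t • gradX L (u t) (deltaDeriv T u t) t) t := fun t ht =>
    (hG t ht.1).comp_sigma hT hlt (continuousOn_sigma hT hσ)
      (continuousOn_of_deltaDifferentiable hT fun s hs => ⟨_, hG s hs⟩) ht.2
      (hσ t ht.2).hasNablaDerivAt
  constructor
  · rintro ⟨c, hc⟩ t ht
    -- Constancy is known only on `T^κ`. This suffices: it contains `ρ(t)` and is a neighbourhood of
    -- `t` in `T`.
    have hρ : rho T t ∈ upperKappa T :=
      mem_upperKappa_of_le hT (rho_mem hT hne t) ht.1 (rho_le hT ht.2.1)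
    refine Tendsto.congr' ?_ (hGσ t ht)
    have hK : upperKappa T ∈ 𝓝[T \ {rho T t}] t := nhdsWithin_mono t sdiff_subset
      (nhdsWithin_upperKappa hT ht.1 ▸ self_mem_nhdsWithin)
    filter_upwards [hK] with s hs
    rw [sub_eq_iff_eq_add.1 (hc s hs), sub_eq_iff_eq_add.1 (hc _ hρ), add_sub_add_left_eq_sub]
  · intro h
    refine ⟨_, fun t ht => eq_of_hasNablaDerivAt_zero hT hlt hq (fun s hs => ?_)
      (left_mem_upperKappa hT hlt) ht⟩
    simpa using (h s hs).sub (hGσ s hs)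

end EulerLagrange

end TimeScale

theorem theorem1 (T : Set ℝ) (hclosed : IsClosed T) (hbdd : Bornology.IsBounded T)
    (hcard : 3 ≤ T.encard)
    (hsigma : ∀ t ∈ TimeScale.lowerKappa T,
      TimeScale.NablaDifferentiableAt T (TimeScale.sigma T) t)
    (n : ℕ) (L : EuclideanSpace ℝ (Fin n) → EuclideanSpace ℝ (Fin n) → ℝ → ℝ)
    (hL : TimeScale.IsLagrangian T L)
    (u : ℝ → EuclideanSpace ℝ (Fin n)) (hu : TimeScale.IsC1rd T u) :
    TimeScale.IsCriticalPoint T L u ↔ TimeScale.SolvesEulerLagrange T L u := by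
  have hT : IsCompact T := Metric.isCompact_of_isClosed_isBounded hclosed hbdd
  have hnt : T.Nontrivial := one_lt_encard_iff_nontrivial.1 (lt_of_lt_of_le (by norm_num) hcard)
  have hlt := TimeScale.left_lt_right hT hnt
  have hσ := TimeScale.continuousOn_sigma hT hsigma
  have hmaps : MapsTo (fun t => (u t, TimeScale.deltaDeriv T u t, t)) (TimeScale.upperKappa T)
      (univ ×ˢ univ ×ˢ TimeScale.upperKappa T) := fun t ht => ⟨mem_univ _, mem_univ _, ht⟩
  have hcurve : ContinuousOn (fun t => (u t, TimeScale.deltaDeriv T u t, t))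
      (TimeScale.upperKappa T) :=
    ((hu.continuousOn hT).mono TimeScale.upperKappa_subset).prodMk
      ((hu.continuousOn_deltaDeriv hT hσ).prodMk continuousOn_id)
  have hg := hL.continuousOn_gradX.comp hcurve hmaps
  have hp := hL.continuousOn_gradV.comp hcurve hmaps
  have hG := fun t (ht : t ∈ TimeScale.upperKappa T) =>
    TimeScale.hasDeltaDerivAt_primitive hT hnt.nonempty hg ht
  have hGσ := (TimeScale.continuousOn_of_deltaDifferentiable hT fun t ht => ⟨_, hG t ht⟩).comp
    (hσ.mono TimeScale.upperKappa_subset) fun t _ => TimeScale.sigma_mem hT hnt.nonempty t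
  have hq := hp.sub hGσ
  rw [TimeScale.isCriticalPoint_iff_exists_const hT hlt hσ hL hu hg hp hq hG,
    TimeScale.exists_const_iff_solvesEulerLagrange hT hlt hsigma hq hG]
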